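/- For $m\ge 0$ and $1\le p<\infty$ let $B_p^m=\{x\in\mathbb R^m:\ (\sum_{j=1}^m|x_j|^p)^{1/p}\le 1\}$ be the closed unit ball of the $\ell_p$-norm on $\mathbb R^m$. Let $n\ge 1$, let $a\in\mathbb R^n$ be a vector of Euclidean norm $1$, let $a^\perp=\{x\in\mathbb R^n:\ \langle x,a\rangle=0\}$, and let $\operatorname{proj}_{a^\perp}$ be the orthogonal projection of $\mathbb R^n$ onto $a^\perp$. Then the function $$p\mapsto \frac{\operatorname{vol}_{n-1}\big(\operatorname{proj}_{a^\perp}(B_p^n)\big)}{\operatorname{vol}_{n-1}\big(B_p^{n-1}\big)}$$ is nondecreasing on $[1,+\infty)$. Here $\operatorname{vol}_{n-1}$ is $(n-1)$-dimensional Lebesgue measure (on $a^\perp$ and on $\mathbb R^{n-1}$ respectively), with $\operatorname{vol}_0$ of a one-point set equal to $1$. -/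

import Mathlib

open MeasureTheory

noncomputable section

/-- The closed unit ball `B_p^n = {x ∈ ℝⁿ : ‖x‖_p ≤ 1}`, where `‖x‖_p = (∑ⱼ |xⱼ|^p)^(1/p)`, for a
real exponent `p > 0`, as a subset of Euclidean space `ℝⁿ`. -/
def lpBall (n : ℕ) (p : ℝ) : Set (EuclideanSpace ℝ (Fin n)) :=
  {x | (∑ j, |x j| ^ p) ^ (1 / p) ≤ 1}

/-- The hyperplane `a^⊥ = {x ∈ ℝⁿ : ⟨x, a⟩ = 0}` perpendicular to `a`, a linear subspace of `ℝⁿ`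
with the induced inner product; its `volume` is the Lebesgue measure of this Euclidean space
(`(n-1)`-dimensional volume when `a ≠ 0`). -/
abbrev perpHyperplane {n : ℕ} (a : EuclideanSpace ℝ (Fin n)) :
    Submodule ℝ (EuclideanSpace ℝ (Fin n)) :=
  (Submodule.span ℝ {a})ᗮ

/-- The orthogonal projection of the set `K` onto the hyperplane `a^⊥`. -/
def projPerp {n : ℕ} (a : EuclideanSpace ℝ (Fin n)) (K : Set (EuclideanSpace ℝ (Fin n))) :
    Set (perpHyperplane a) :=
  (perpHyperplane a).orthogonalProjectionOnto '' K

end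

open Set Filter Topology

/-! The ratio equals `E |∑ⱼ aⱼ Γ(1/p) sign(Xⱼ) |Xⱼ|^(p-1)|`, where the `Xⱼ` are independent with
density proportional to `exp (-|x|^p)`; each one-variable contribution then grows with `p`.

For the formula, restrict `h = ‖·‖_p^p` to a line `y + ℝ a`. There `h` is convex and coercive, so `∫
|h'| exp (-h) = 2 exp (-min h)`, and `min h` is the `p`-th power of the `ℓ_p`-distance from `y` to
`ℝ a` (`lintegral_line_eq`). This distance is the gauge on `a^⊥` of the projected ball, so
integrating over `y` gives its volume up to a Gamma factor (`volume_projPerp_lpBall`,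
`volume_projPerp_div_volume_lpBall`).

For monotonicity, symmetry turns `E |s + a ψ(X)|`, with `ψ` the normalised signed power, into `E
max(|s|, |a| T_p)`, where `T_p = Γ(1/p) |X|^(p-1)` has mean 1 for every `p`. The densities of `T_p`
and `T_q` cross so that `T_p` precedes `T_q` in the convex order when `p ≤ q`
(`ordConnected_powDensity_lt`, `setIntegral_max_mul_le_of_ordConnected`). Replacing the variables
one at a time carries this to the sum (`lintegral_enorm_add_sum_mono`). -/

noncomputable section

/-! ### Total variation of `exp (-h)` on a line. -/

section LineIntegral

variable {h D : ℝ → ℝ} {S : Set ℝ} {m : ℝ}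

/-- A monotone function that is off a countable set the derivative of a function with a minimum
at `m` is nonnegative to the right of `m`. -/
theorem nonneg_of_monotone_of_isMin (hc : Continuous h) (hD : Monotone D) (hS : S.Countable)
    (hd : ∀ s, s ∉ S → HasDerivAt h (D s) s) (hm : ∀ s, h m ≤ h s) {s : ℝ} (hs : m < s) :
    0 ≤ D s := by
  by_contra! hneg
  have h1 : ∫ x in m..s, D x = h s - h m :=
    integral_eq_of_hasDerivAt_off_countable_of_le h D hs.le hS hc.continuousOn
      (fun x hx => hd x hx.2) hD.intervalIntegrable
  have h2 : ∫ x in m..s, D x ≤ ∫ _ in m..s, D s :=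
    intervalIntegral.integral_mono_on hs.le hD.intervalIntegrable
      intervalIntegrable_const fun x hx => hD hx.2
  rw [h1, intervalIntegral.integral_const, smul_eq_mul] at h2
  nlinarith [hm s, sub_pos.2 hs]

/-- To the right of the minimum `D ≥ 0`, so the integrand is the derivative of `-exp (-h)`, which
tends to 0 by coercivity. -/
theorem lintegral_Ioi_abs_mul_exp_neg (hc : Continuous h) (hD : Monotone D) (hS : S.Countable)
    (hd : ∀ s, s ∉ S → HasDerivAt h (D s) s) (hm : ∀ s, h m ≤ h s)
    (htop : Tendsto h atTop atTop) :
    ∫⁻ s in Ioi m, ENNReal.ofReal (|D s| * Real.exp (-h s)) =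
      ENNReal.ofReal (Real.exp (-h m)) := by
  have hnn : ∀ s, m < s → 0 ≤ D s := fun s hs => nonneg_of_monotone_of_isMin hc hD hS hd hm hs
  have hce : Continuous fun s => Real.exp (-h s) := by fun_prop
  have hii : ∀ b, IntervalIntegrable (fun s => D s * Real.exp (-h s)) volume m b := fun b =>
    hD.intervalIntegrable.mul_continuousOn hce.continuousOn
  have hfin : ∀ b, m ≤ b → ∫ s in m..b, D s * Real.exp (-h s) =
      Real.exp (-h m) - Real.exp (-h b) := by
    intro b hb
    have := integral_eq_of_hasDerivAt_off_countable_of_le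
      (fun s => -Real.exp (-h s)) (fun s => D s * Real.exp (-h s)) hb hS
      hce.neg.continuousOn (fun x hx => by
        convert! ((hd x hx.2).fun_neg.exp).fun_neg using 1
        ring) (hii b)
    rw [this]; ring
  have hlim : Tendsto (fun b => ∫ s in m..b, D s * Real.exp (-h s)) atTop
      (𝓝 (Real.exp (-h m))) := by
    have h0 : Tendsto (fun b => Real.exp (-h m) - Real.exp (-h b)) atTop
        (𝓝 (Real.exp (-h m) - 0)) :=
      tendsto_const_nhds.sub (Real.tendsto_exp_neg_atTop_nhds_zero.comp htop)
    rw [sub_zero] at h0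
    refine h0.congr' ?_
    filter_upwards [eventually_ge_atTop m] with b hb using (hfin b hb).symm
  have hnorm : ∀ b, m ≤ b → ∫ s in m..b, ‖D s * Real.exp (-h s)‖ =
      ∫ s in m..b, D s * Real.exp (-h s) := by
    intro b hb
    rw [intervalIntegral.integral_of_le hb, intervalIntegral.integral_of_le hb]
    refine setIntegral_congr_fun measurableSet_Ioc fun s hs => ?_
    exact Real.norm_of_nonneg (mul_nonneg (hnn s hs.1) (Real.exp_pos _).le)
  have hint : IntegrableOn (fun s => D s * Real.exp (-h s)) (Ioi m) := by
    refine integrableOn_Ioi_of_intervalIntegral_norm_tendsto (l := atTop) (b := id)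
      (Real.exp (-h m)) m (fun b => (hii b).1) tendsto_id ?_
    refine hlim.congr' ?_
    filter_upwards [eventually_ge_atTop m] with b hb using (hnorm b hb).symm
  have hval : ∫ s in Ioi m, D s * Real.exp (-h s) = Real.exp (-h m) :=
    tendsto_nhds_unique (intervalIntegral_tendsto_integral_Ioi m hint tendsto_id) hlim
  rw [← hval, ofReal_integral_eq_lintegral_ofReal hint]
  · refine setLIntegral_congr_fun measurableSet_Ioi fun s hs => ?_
    simp only [abs_of_nonneg (hnn s hs)]
  · filter_upwards [ae_restrict_mem measurableSet_Ioi] with s hs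
    exact mul_nonneg (hnn s hs) (Real.exp_pos _).le

/-- The total variation of `exp (-h)` is twice its maximum, for `h` convex and coercive. -/
theorem lintegral_abs_mul_exp_neg (hc : Continuous h) (hD : Monotone D) (hS : S.Countable)
    (hd : ∀ s, s ∉ S → HasDerivAt h (D s) s) (hm : ∀ s, h m ≤ h s)
    (htop : Tendsto h atTop atTop) (hbot : Tendsto h atBot atTop) :
    ∫⁻ s, ENNReal.ofReal (|D s| * Real.exp (-h s)) =
      2 * ENNReal.ofReal (Real.exp (-h m)) := by
  have h1 := lintegral_Ioi_abs_mul_exp_neg hc hD hS hd hm htop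
  -- The left half-line is the right half-line of the reflected function.
  have h2 := lintegral_Ioi_abs_mul_exp_neg (h := fun s => h (-s)) (D := fun s => -D (-s))
    (S := Neg.neg ⁻¹' S) (m := -m) (by fun_prop) (fun s t hst => by
      have := hD (neg_le_neg hst)
      simpa using this) (hS.preimage neg_injective) (fun s hs => by
      convert! (hd (-s) hs).comp s (hasDerivAt_neg s) using 1
      ring) (fun s => by simpa using hm (-s)) (hbot.comp tendsto_neg_atTop_atBot)
  have h3 : ∫⁻ s in Iio m, ENNReal.ofReal (|D s| * Real.exp (-h s)) =
      ENNReal.ofReal (Real.exp (-h m)) := by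
    have := (Measure.measurePreserving_neg (volume : Measure ℝ)).setLIntegral_comp_preimage_emb
      (MeasurableEquiv.neg ℝ).measurableEmbedding
      (fun s => ENNReal.ofReal (|D s| * Real.exp (-h s))) (Iio m)
    rw [← this]
    simp only [abs_neg, neg_neg] at h2
    rw [← h2]
    congr 2
    ext s
    simp
  rw [← lintegral_add_compl _ (measurableSet_Ioi (a := m)), h1, compl_Ioi,
    setLIntegral_congr Iio_ae_eq_Iic.symm, h3, two_mul]

end LineIntegral

theorem lintegral_eq_lintegral_perpHyperplane {n : ℕ} {a : EuclideanSpace ℝ (Fin n)}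
    (ha : ‖a‖ = 1) {f : EuclideanSpace ℝ (Fin n) → ENNReal} (hf : Measurable f) :
    ∫⁻ x, f x = ∫⁻ y : perpHyperplane a, ∫⁻ s : ℝ, f (y + s • a) := by
  have h1 := ((Submodule.span ℝ {a}).orthogonalDecomposition.symm.measurePreserving.comp
    (WithLp.volume_preserving_toLp _ _))
  rw [← h1.lintegral_comp hf, Measure.volume_eq_prod, lintegral_prod_symm']
  · refine lintegral_congr fun y => ?_
    rw [← (LinearIsometryEquiv.toSpanUnitSingleton (𝕜 := ℝ) a ha).measurePreserving.lintegral_comp]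
    · refine lintegral_congr fun s => ?_
      simp [add_comm]
    · exact (hf.comp h1.measurable).comp (by fun_prop)
  · exact hf.comp h1.measurable

/-- The signed power `sign x * |x| ^ r`. -/
def signedPow (r x : ℝ) : ℝ := SignType.sign x * |x| ^ r

theorem signedPow_of_pos {r x : ℝ} (hx : 0 < x) : signedPow r x = x ^ r := by
  simp [signedPow, sign_pos hx, abs_of_pos hx]

theorem signedPow_neg (r x : ℝ) : signedPow r (-x) = -signedPow r x := by
  simp [signedPow, Left.sign_neg]

theorem signedPow_monotone {r : ℝ} (hr : 0 ≤ r) : Monotone (signedPow r) := by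
  have hpos : ∀ x, 0 ≤ x → 0 ≤ signedPow r x := by
    intro x hx
    rcases hx.eq_or_lt with rfl | hx
    · simp [signedPow]
    · rw [signedPow_of_pos hx]; positivity
  have hmono : ∀ x y, 0 ≤ x → x ≤ y → signedPow r x ≤ signedPow r y := by
    intro x y hx hxy
    rcases hx.eq_or_lt with rfl | hx
    · simpa [signedPow] using hpos y hxy
    · rw [signedPow_of_pos hx, signedPow_of_pos (hx.trans_le hxy)]
      exact Real.rpow_le_rpow hx.le hxy hr
  intro x y hxy
  rcases le_total 0 x with hx | hx
  · exact hmono x y hx hxy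
  · have h1 : signedPow r x ≤ 0 := by
      have := hpos (-x) (by linarith)
      rw [signedPow_neg] at this; linarith
    rcases le_total 0 y with hy | hy
    · exact h1.trans (hpos y hy)
    · have := hmono (-y) (-x) (by linarith) (by linarith)
      rw [signedPow_neg, signedPow_neg] at this; linarith

theorem measurable_signedPow {r : ℝ} (hr : 0 ≤ r) : Measurable (signedPow r) :=
  (signedPow_monotone hr).measurable

theorem hasDerivAt_abs_rpow_of_ne {p x : ℝ} (hx : x ≠ 0) :
    HasDerivAt (fun x : ℝ => |x| ^ p) (p * signedPow (p - 1) x) x := by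
  convert! (hasDerivAt_abs hx).rpow_const (p := p) (Or.inl (abs_ne_zero.2 hx)) using 1
  rw [signedPow]; ring

/-! ### The `ℓ_p`-norm on Euclidean space. -/

/-- The `ℓ_p`-norm of a vector of Euclidean space. -/
def rpowNorm {n : ℕ} (p : ℝ) (x : EuclideanSpace ℝ (Fin n)) : ℝ := (∑ j, |x j| ^ p) ^ (1 / p)

section rpowNorm

variable {n : ℕ} {p : ℝ}

theorem rpowNorm_nonneg (x : EuclideanSpace ℝ (Fin n)) : 0 ≤ rpowNorm p x :=
  Real.rpow_nonneg (Finset.sum_nonneg fun _ _ => Real.rpow_nonneg (abs_nonneg _) _) _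

theorem rpowNorm_rpow (hp : 1 ≤ p) (x : EuclideanSpace ℝ (Fin n)) :
    rpowNorm p x ^ p = ∑ j, |x j| ^ p := by
  rw [rpowNorm, ← Real.rpow_mul (Finset.sum_nonneg fun _ _ => Real.rpow_nonneg (abs_nonneg _) _),
    one_div_mul_cancel (by linarith), Real.rpow_one]

theorem rpowNorm_eq_norm_toLp (hp : 1 ≤ p) (x : EuclideanSpace ℝ (Fin n)) :
    haveI : Fact (1 ≤ ENNReal.ofReal p) := ⟨ENNReal.ofReal_one ▸ ENNReal.ofReal_le_ofReal hp⟩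
    rpowNorm p x = ‖WithLp.toLp (.ofReal p) x.ofLp‖ := by
  have h : (ENNReal.ofReal p).toReal = p := ENNReal.toReal_ofReal (by linarith)
  have h' : 0 < (ENNReal.ofReal p).toReal := by linarith
  simp [rpowNorm, PiLp.norm_eq_sum (f := WithLp.toLp (.ofReal p) x.ofLp) h', h]

theorem rpowNorm_add_le (hp : 1 ≤ p) (x y : EuclideanSpace ℝ (Fin n)) :
    rpowNorm p (x + y) ≤ rpowNorm p x + rpowNorm p y := by
  have : Fact (1 ≤ ENNReal.ofReal p) := ⟨ENNReal.ofReal_one ▸ ENNReal.ofReal_le_ofReal hp⟩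
  simp only [rpowNorm_eq_norm_toLp hp]
  exact norm_add_le (WithLp.toLp (.ofReal p) x.ofLp) (WithLp.toLp (.ofReal p) y.ofLp)

theorem rpowNorm_smul (hp : 1 ≤ p) (r : ℝ) (x : EuclideanSpace ℝ (Fin n)) :
    rpowNorm p (r • x) = |r| * rpowNorm p x := by
  have : Fact (1 ≤ ENNReal.ofReal p) := ⟨ENNReal.ofReal_one ▸ ENNReal.ofReal_le_ofReal hp⟩
  simp only [rpowNorm_eq_norm_toLp hp]
  exact norm_smul r (WithLp.toLp (.ofReal p) x.ofLp)

theorem rpowNorm_eq_zero (hp : 1 ≤ p) {x : EuclideanSpace ℝ (Fin n)} (h : rpowNorm p x = 0) :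
    x = 0 := by
  have : Fact (1 ≤ ENNReal.ofReal p) := ⟨ENNReal.ofReal_one ▸ ENNReal.ofReal_le_ofReal hp⟩
  rw [rpowNorm_eq_norm_toLp hp, norm_eq_zero, WithLp.toLp_eq_zero] at h
  exact WithLp.ofLp_injective _ h

theorem continuous_rpowNorm (hp : 1 ≤ p) :
    Continuous (rpowNorm p : EuclideanSpace ℝ (Fin n) → ℝ) := by
  unfold rpowNorm
  refine Continuous.rpow_const (continuous_finsetSum _ fun j _ => Continuous.rpow_const
    (by fun_prop) fun _ => Or.inr (by linarith)) fun _ => Or.inr (by positivity)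

end rpowNorm

/-! ### The projected ball as a sublevel set of the distance to `ℝ a`. -/

section Projection

variable {n : ℕ} {p : ℝ} {a : EuclideanSpace ℝ (Fin n)}

theorem tendsto_sum_abs_rpow (hp : 1 ≤ p) (ha : a ≠ 0) (y : EuclideanSpace ℝ (Fin n)) :
    Tendsto (fun s : ℝ => ∑ j, |(y + s • a) j| ^ p) (cocompact ℝ) atTop := by
  obtain ⟨j, hj⟩ : ∃ j, a j ≠ 0 := by
    by_contra! h
    exact ha (by ext j; simpa using h j)
  have h1 : Tendsto (fun s : ℝ => y j + s * a j) (cocompact ℝ) (cocompact ℝ) := by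
    let e : ℝ ≃ₜ ℝ := (Homeomorph.mulRight₀ (a j) hj).trans (Homeomorph.addLeft (y j))
    exact e.isClosedEmbedding.tendsto_cocompact
  have h2 : Tendsto (fun s : ℝ => |y j + s * a j| ^ p) (cocompact ℝ) atTop :=
    (tendsto_rpow_atTop (by linarith)).comp ((tendsto_norm_cocompact_atTop (E := ℝ)).comp h1)
  refine tendsto_atTop_mono (fun s => ?_) h2
  have := Finset.single_le_sum (f := fun j => |(y + s • a) j| ^ p)
    (fun i _ => Real.rpow_nonneg (abs_nonneg _) _) (Finset.mem_univ j)
  simpa using this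

theorem continuous_sum_abs_rpow (hp : 1 ≤ p) (y : EuclideanSpace ℝ (Fin n)) :
    Continuous (fun s : ℝ => ∑ j, |(y + s • a) j| ^ p) := by
  refine continuous_finsetSum _ fun j _ => Continuous.rpow_const
    (by fun_prop) fun _ => Or.inr (by linarith)

theorem exists_forall_rpowNorm_le (hp : 1 ≤ p) (ha : a ≠ 0) (y : EuclideanSpace ℝ (Fin n)) :
    ∃ m : ℝ, ∀ s : ℝ, rpowNorm p (y + m • a) ≤ rpowNorm p (y + s • a) := by
  obtain ⟨m, hm⟩ := (continuous_sum_abs_rpow hp y).exists_forall_le (tendsto_sum_abs_rpow hp ha y)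
  exact ⟨m, fun s => Real.rpow_le_rpow
    (Finset.sum_nonneg fun _ _ => Real.rpow_nonneg (abs_nonneg _) _) (hm s) (by positivity)⟩

/-- The distance from `y` to the line `ℝ a` in the `ℓ_p`-norm. -/
def lpDistLine (p : ℝ) (a y : EuclideanSpace ℝ (Fin n)) : ℝ := ⨅ s : ℝ, rpowNorm p (y + s • a)

theorem lpDistLine_le (y : EuclideanSpace ℝ (Fin n)) (s : ℝ) :
    lpDistLine p a y ≤ rpowNorm p (y + s • a) :=
  ciInf_le ⟨0, by rintro _ ⟨s, rfl⟩; exact rpowNorm_nonneg _⟩ s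

theorem exists_lpDistLine_eq (hp : 1 ≤ p) (ha : a ≠ 0) (y : EuclideanSpace ℝ (Fin n)) :
    ∃ m : ℝ, lpDistLine p a y = rpowNorm p (y + m • a) := by
  obtain ⟨m, hm⟩ := exists_forall_rpowNorm_le hp ha y
  exact ⟨m, le_antisymm (lpDistLine_le y m) (le_ciInf hm)⟩

theorem lintegral_line_eq (hp : 1 ≤ p) (ha : a ≠ 0) (y : EuclideanSpace ℝ (Fin n)) :
    ∫⁻ s : ℝ, ENNReal.ofReal (|∑ j, a j * (p * signedPow (p - 1) ((y + s • a) j))| *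
      Real.exp (-∑ j, |(y + s • a) j| ^ p)) =
      2 * ENNReal.ofReal (Real.exp (-lpDistLine p a y ^ p)) := by
  obtain ⟨m, hm⟩ := exists_lpDistLine_eq hp ha y
  have hlim := tendsto_sum_abs_rpow hp ha y
  rw [cocompact_eq_atBot_atTop, tendsto_sup] at hlim
  rw [hm, rpowNorm_rpow hp]
  -- Only coordinates with `a j ≠ 0` contribute exceptional points, one each; the others are
  -- constant along the line, so they cause no trouble even where `|·|^p` has a corner.
  refine lintegral_abs_mul_exp_neg (h := fun s => ∑ j, |(y + s • a) j| ^ p)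
    (S := ⋃ j : Fin n, {s | a j ≠ 0 ∧ (y + s • a) j = 0})
    (continuous_sum_abs_rpow hp y) ?_ ?_ ?_ ?_ hlim.2 hlim.1
  · intro s t hst
    refine Finset.sum_le_sum fun j _ => ?_
    have hp0 : (0 : ℝ) ≤ p := by linarith
    rcases le_total 0 (a j) with h | h
    · refine mul_le_mul_of_nonneg_left (mul_le_mul_of_nonneg_left
        (signedPow_monotone (by linarith) ?_) hp0) h
      simp only [PiLp.add_apply, PiLp.smul_apply, smul_eq_mul]
      nlinarith
    · refine mul_le_mul_of_nonpos_left (mul_le_mul_of_nonneg_left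
        (signedPow_monotone (by linarith) ?_) hp0) h
      simp only [PiLp.add_apply, PiLp.smul_apply, smul_eq_mul]
      nlinarith
  · refine countable_iUnion fun j => Set.Subsingleton.countable ?_
    rintro s ⟨h, hs⟩ t ⟨-, ht⟩
    simp only [PiLp.add_apply, PiLp.smul_apply, smul_eq_mul] at hs ht
    exact mul_right_cancel₀ h (by linarith)
  · intro s hs
    simp only [mem_iUnion, mem_ofPred_eq, not_exists, not_and] at hs
    refine HasDerivAt.fun_sum fun j _ => ?_
    by_cases h : a j = 0
    · simpa [h] using hasDerivAt_const s (|y j| ^ p)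
    · have h1 : HasDerivAt (fun s : ℝ => (y + s • a) j) (a j) s := by
        simpa using ((hasDerivAt_id s).mul_const (a j)).const_add (y j)
      convert! (hasDerivAt_abs_rpow_of_ne (p := p) (hs j h)).comp s h1 using 1
      ring
  · intro s
    have := (hm ▸ lpDistLine_le y s : rpowNorm p (y + m • a) ≤ rpowNorm p (y + s • a))
    have := Real.rpow_le_rpow (rpowNorm_nonneg _) this (by linarith : 0 ≤ p)
    rwa [rpowNorm_rpow hp, rpowNorm_rpow hp] at this

/-- The fibres of the projection are the lines parallel to `a`, and the distance is attained on
each, so the inequality is not strict. -/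
theorem projPerp_lpBall (hp : 1 ≤ p) (ha : a ≠ 0) :
    projPerp a (lpBall n p) = {y : perpHyperplane a | lpDistLine p a y ≤ 1} := by
  ext y
  constructor
  · rintro ⟨x, hx, rfl⟩
    have hx' : x - (perpHyperplane a).orthogonalProjectionOnto x ∈ Submodule.span ℝ {a} := by
      have := (perpHyperplane a).sub_starProjection_mem_orthogonal x
      rwa [Submodule.orthogonal_orthogonal] at this
    obtain ⟨s, hs⟩ := Submodule.mem_span_singleton.1 hx'
    refine (lpDistLine_le _ s).trans ?_
    rw [hs, add_sub_cancel]
    exact hx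
  · intro hy
    obtain ⟨m, hm⟩ := exists_lpDistLine_eq hp ha (y : EuclideanSpace ℝ (Fin n))
    refine ⟨y + m • a, ?_, ?_⟩
    · change rpowNorm p _ ≤ 1
      rw [← hm]; exact hy
    · have hma : (perpHyperplane a).orthogonalProjectionOnto (m • a) = 0 := by
        rw [Submodule.orthogonalProjectionOnto_eq_zero_iff, Submodule.orthogonal_orthogonal]
        exact Submodule.smul_mem _ _ (Submodule.mem_span_singleton_self a)
      rw [map_add, hma, add_zero, Submodule.orthogonalProjectionOnto_mem_subspace_eq_self]

end Projection

theorem finrank_perpHyperplane {n : ℕ} {a : EuclideanSpace ℝ (Fin n)} (ha : a ≠ 0) :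
    Module.finrank ℝ (perpHyperplane a) = n - 1 := by
  have h := (Submodule.span ℝ {a}).finrank_add_finrank_orthogonal
  rw [finrank_span_singleton ha, finrank_euclideanSpace_fin] at h
  exact Nat.eq_sub_of_add_eq' h

/-! ### The distance as a gauge, and volumes as integrals. -/

section DistLine

variable {n : ℕ} {p : ℝ} {a : EuclideanSpace ℝ (Fin n)}

theorem rpowNorm_zero (hp : 1 ≤ p) : rpowNorm p (0 : EuclideanSpace ℝ (Fin n)) = 0 := by
  simpa using rpowNorm_smul hp 0 (0 : EuclideanSpace ℝ (Fin n))

theorem lpDistLine_nonneg (y : EuclideanSpace ℝ (Fin n)) : 0 ≤ lpDistLine p a y :=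
  Real.iInf_nonneg fun _ => rpowNorm_nonneg _

theorem lpDistLine_le_rpowNorm (y : EuclideanSpace ℝ (Fin n)) :
    lpDistLine p a y ≤ rpowNorm p y := by
  simpa using lpDistLine_le (p := p) (a := a) y 0

theorem lpDistLine_zero (hp : 1 ≤ p) : lpDistLine p a 0 = 0 :=
  le_antisymm ((lpDistLine_le_rpowNorm 0).trans_eq (rpowNorm_zero hp)) (lpDistLine_nonneg _)

theorem lpDistLine_smul_le (hp : 1 ≤ p) (ha : a ≠ 0) (r : ℝ) (y : EuclideanSpace ℝ (Fin n)) :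
    lpDistLine p a (r • y) ≤ |r| * lpDistLine p a y := by
  obtain ⟨m, hm⟩ := exists_lpDistLine_eq hp ha y
  rw [hm, ← rpowNorm_smul hp, smul_add, smul_smul]
  exact lpDistLine_le _ _

theorem lpDistLine_neg (hp : 1 ≤ p) (ha : a ≠ 0) (y : EuclideanSpace ℝ (Fin n)) :
    lpDistLine p a (-y) = lpDistLine p a y := by
  have h : ∀ z : EuclideanSpace ℝ (Fin n), lpDistLine p a (-z) ≤ lpDistLine p a z := fun z => by
    simpa using lpDistLine_smul_le hp ha (-1) z
  exact le_antisymm (h y) (by simpa using h (-y))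

theorem lpDistLine_add_le (hp : 1 ≤ p) (ha : a ≠ 0) (x y : EuclideanSpace ℝ (Fin n)) :
    lpDistLine p a (x + y) ≤ lpDistLine p a x + lpDistLine p a y := by
  obtain ⟨m, hm⟩ := exists_lpDistLine_eq hp ha x
  obtain ⟨k, hk⟩ := exists_lpDistLine_eq hp ha y
  rw [hm, hk]
  refine le_trans ?_ (rpowNorm_add_le hp _ _)
  convert! lpDistLine_le (p := p) (a := a) (x + y) (m + k) using 2
  rw [add_smul]; abel

theorem eq_zero_of_lpDistLine_eq_zero (hp : 1 ≤ p) (ha : a ≠ 0) {y : perpHyperplane a}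
    (h : lpDistLine p a y = 0) : y = 0 := by
  obtain ⟨m, hm⟩ := exists_lpDistLine_eq hp ha (y : EuclideanSpace ℝ (Fin n))
  have h1 := rpowNorm_eq_zero hp (hm ▸ h)
  have h2 : (y : EuclideanSpace ℝ (Fin n)) ∈ Submodule.span ℝ {a} := by
    rw [eq_neg_of_add_eq_zero_left h1]
    exact Submodule.neg_mem _ (Submodule.smul_mem _ _ (Submodule.mem_span_singleton_self a))
  have h3 : (y : EuclideanSpace ℝ (Fin n)) = 0 := by
    have := y.2 _ h2
    rwa [inner_self_eq_zero] at this
  exact Subtype.ext h3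

theorem measurable_sum_signedPow (hp : 1 ≤ p) (a : Fin n → ℝ) :
    Measurable fun x : EuclideanSpace ℝ (Fin n) =>
      ENNReal.ofReal (|∑ j, a j * (p * signedPow (p - 1) (x j))| *
        Real.exp (-∑ j, |x j| ^ p)) := by
  have h1 : ∀ j, Measurable fun x : EuclideanSpace ℝ (Fin n) => signedPow (p - 1) (x j) :=
    fun j => (measurable_signedPow (by linarith)).comp (by fun_prop)
  fun_prop

/-- The line formula writes this function as half of a parametric integral, so Tonelli gives
measurability without treating the infimum. -/
theorem measurable_exp_neg_lpDistLine (hp : 1 ≤ p) (ha : a ≠ 0) :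
    Measurable fun y : perpHyperplane a => Real.exp (-lpDistLine p a y ^ p) := by
  have h1 : Measurable fun y : perpHyperplane a =>
      (2 : ENNReal) * ENNReal.ofReal (Real.exp (-lpDistLine p a y ^ p)) := by
    simp_rw [← lintegral_line_eq hp ha]
    exact Measurable.lintegral_prod_right'
      (f := fun z : perpHyperplane a × ℝ => ENNReal.ofReal (|∑ j, a j *
        (p * signedPow (p - 1) (((z.1 : EuclideanSpace ℝ (Fin n)) + z.2 • a) j))| *
        Real.exp (-∑ j, |((z.1 : EuclideanSpace ℝ (Fin n)) + z.2 • a) j| ^ p)))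
      ((measurable_sum_signedPow hp a).comp (by fun_prop))
  convert! (h1.ennreal_toReal).div_const 2 using 2 with y
  simp [ENNReal.toReal_ofReal (Real.exp_pos _).le]

/-- The volume of the projection of the `ℓ_p`-ball as an integral over the whole space. -/
theorem volume_projPerp_lpBall (hp : 1 ≤ p) (ha : ‖a‖ = 1) :
    2 * ENNReal.ofReal (Real.Gamma ((n - 1 : ℕ) / p + 1)) * volume (projPerp a (lpBall n p)) =
      ∫⁻ x : EuclideanSpace ℝ (Fin n),
        ENNReal.ofReal (|∑ j, a j * (p * signedPow (p - 1) (x j))| *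
          Real.exp (-∑ j, |x j| ^ p)) := by
  have ha0 : a ≠ 0 := by rintro rfl; simp at ha
  have hp0 : 0 < p := by linarith
  set g : perpHyperplane a → ℝ := fun y => lpDistLine p a y with hg
  have h1 : g 0 = 0 := lpDistLine_zero hp
  have h2 : ∀ y, g (-y) = g y := fun y => lpDistLine_neg hp ha0 _
  have h3 : ∀ x y, g (x + y) ≤ g x + g y := fun x y => lpDistLine_add_le hp ha0 _ _
  have h4 : ∀ {y}, g y = 0 → y = 0 := fun h => eq_zero_of_lpDistLine_eq_zero hp ha0 h
  have h5 : ∀ (r : ℝ) y, g (r • y) ≤ |r| * g y := fun r y => lpDistLine_smul_le hp ha0 r _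
  have hΓ : 0 < Real.Gamma ((n - 1 : ℕ) / p + 1) := Real.Gamma_pos_of_pos (by positivity)
  have hle : volume (projPerp a (lpBall n p)) = volume {y | g y < 1} := by
    rw [projPerp_lpBall hp ha0]
    -- When `a^⊥` is a point (`n = 1`), both sublevel sets are that point.
    rcases subsingleton_or_nontrivial (perpHyperplane a) with hs | hs
    · congr 1
      ext y
      rw [mem_ofPred_eq, mem_ofPred_eq, Subsingleton.elim y 0]
      change g 0 ≤ 1 ↔ g 0 < 1
      simp [h1]
    · exact measure_le_eq_lt volume h1 h2 h3 h4 h5 1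
  have hlt := measure_lt_one_eq_integral_div_gamma volume h1 h2 h3 h4 h5 hp0
  rw [finrank_perpHyperplane ha0] at hlt
  have hpos : 0 < volume {y | g y < 1} := by
    have hopen : IsOpen {y : perpHyperplane a | rpowNorm p (y : EuclideanSpace ℝ (Fin n)) < 1} :=
      isOpen_lt ((continuous_rpowNorm hp).comp continuous_subtype_val) continuous_const
    refine (hopen.measure_pos volume ⟨0, ?_⟩).trans_le
      (measure_mono fun y hy => (lpDistLine_le_rpowNorm _).trans_lt hy)
    simp [rpowNorm_zero hp]
  -- A non-integrable function would have integral 0 by convention, contradicting the positive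
  -- volume.
  have hI : Integrable fun y => Real.exp (-g y ^ p) := by
    refine Integrable.of_integral_ne_zero fun h0 => ?_
    rw [hlt, h0] at hpos
    simp at hpos
  rw [hle, hlt, mul_assoc, ← ENNReal.ofReal_mul hΓ.le, mul_div_cancel₀ _ hΓ.ne',
    ofReal_integral_eq_lintegral_ofReal hI (ae_of_all _ fun _ => (Real.exp_pos _).le),
    lintegral_eq_lintegral_perpHyperplane ha (measurable_sum_signedPow hp a),
    lintegral_congr fun y : perpHyperplane a => lintegral_line_eq hp ha0 y,
    lintegral_const_mul _ (measurable_exp_neg_lpDistLine hp ha0).ennreal_ofReal]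

theorem volume_lpBall (m : ℕ) (hp : 1 ≤ p) :
    volume (lpBall m p) =
      ENNReal.ofReal ((2 * Real.Gamma (1 / p + 1)) ^ m / Real.Gamma (m / p + 1)) := by
  have h := (EuclideanSpace.volume_preserving_symm_measurableEquiv_toLp
    (Fin m)).measure_preimage_equiv {x : Fin m → ℝ | (∑ j, |x j| ^ p) ^ (1 / p) ≤ 1}
  change volume (lpBall m p) = _ at h
  rw [h]
  rcases Nat.eq_zero_or_pos m with rfl | hm
  · have : {x : Fin 0 → ℝ | (∑ j, |x j| ^ p) ^ (1 / p) ≤ 1} = univ := by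
      ext x
      simp [Real.zero_rpow (inv_ne_zero (by linarith : p ≠ 0))]
    rw [this]
    simp [volume_pi]
  · have : Nonempty (Fin m) := ⟨⟨0, hm⟩⟩
    simpa using volume_sum_rpow_le (Fin m) hp 1

end DistLine

/-! ### Convex order from the crossing of densities. -/

section Crossing

variable {f g : ℝ → ℝ}

theorem integrable_max_mul {α : Type*} [MeasurableSpace α] {μ : Measure α} {τ φ : α → ℝ}
    (hτ : Measurable τ) (hφ : Integrable φ μ) (hφ1 : Integrable (fun x => τ x * φ x) μ) (c : ℝ) :
    Integrable (fun x => max c (τ x) * φ x) μ := by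
  refine Integrable.mono' ((hφ.norm.const_mul |c|).add hφ1.norm)
    ((measurable_const.max hτ).aestronglyMeasurable.mul hφ.1) ?_
  filter_upwards with x
  simp only [norm_mul, Real.norm_eq_abs, Pi.add_apply]
  rw [← add_mul]
  refine mul_le_mul_of_nonneg_right ?_ (abs_nonneg _)
  rcases max_choice c (τ x) with h | h <;> rw [h] <;> linarith [abs_nonneg (τ x), abs_nonneg c]

/-- If `g < f` exactly on an order-connected set and `f`, `g` have the same mass and mean, then
`f` is smaller than `g` in the convex order; stated for the functions `max c`. -/
theorem setIntegral_max_mul_le_of_ordConnected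
    (hf : IntegrableOn f (Ioi 0)) (hg : IntegrableOn g (Ioi 0))
    (hf1 : IntegrableOn (fun t => t * f t) (Ioi 0)) (hg1 : IntegrableOn (fun t => t * g t) (Ioi 0))
    (h0 : ∫ t in Ioi (0 : ℝ), f t = ∫ t in Ioi (0 : ℝ), g t)
    (h1 : ∫ t in Ioi (0 : ℝ), t * f t = ∫ t in Ioi (0 : ℝ), t * g t)
    (hS : OrdConnected {t : ℝ | 0 < t ∧ g t < f t}) (c : ℝ) :
    ∫ t in Ioi (0 : ℝ), max c t * f t ≤ ∫ t in Ioi (0 : ℝ), max c t * g t := by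
  set S := {t : ℝ | 0 < t ∧ g t < f t} with hSdef
  have hSg : ∀ t, 0 < t → t ∉ S → f t ≤ g t := fun t ht hn => by
    by_contra! h
    exact hn ⟨ht, h⟩
  have hmax : ∀ φ : ℝ → ℝ, IntegrableOn φ (Ioi 0) → IntegrableOn (fun t => t * φ t) (Ioi 0) →
      IntegrableOn (fun t => max c t * φ t) (Ioi 0) := fun φ hφ hφ1 =>
    integrable_max_mul measurable_id hφ hφ1 c
  -- it suffices to find an affine function crossing `max c` at the endpoints of `S`
  suffices h : ∃ u v : ℝ, (∀ t ∈ S, max c t ≤ u + v * t) ∧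
      ∀ t, 0 < t → t ∉ S → u + v * t ≤ max c t by
    obtain ⟨u, v, hin, hout⟩ := h
    -- This is `(max c t - (u + v t)) (f t - g t) ≤ 0`; the affine part has equal integrals against
    -- `f` and `g`.
    have key : ∀ t ∈ Ioi (0 : ℝ),
        max c t * f t + (u * g t + v * (t * g t)) ≤ max c t * g t + (u * f t + v * (t * f t)) := by
      intro t ht
      by_cases hts : t ∈ S
      · nlinarith [hin t hts, hts.2]
      · nlinarith [hout t ht hts, hSg t ht hts]
    have hl : ∀ φ : ℝ → ℝ, IntegrableOn φ (Ioi 0) → IntegrableOn (fun t => t * φ t) (Ioi 0) →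
        IntegrableOn (fun t => u * φ t + v * (t * φ t)) (Ioi 0) := fun φ hφ hφ1 =>
      (hφ.const_mul u).add (hφ1.const_mul v)
    have hlv : ∀ φ : ℝ → ℝ, IntegrableOn φ (Ioi 0) → IntegrableOn (fun t => t * φ t) (Ioi 0) →
        ∫ t in Ioi (0 : ℝ), (u * φ t + v * (t * φ t)) =
          u * (∫ t in Ioi (0 : ℝ), φ t) + v * ∫ t in Ioi (0 : ℝ), t * φ t := fun φ hφ hφ1 => by
      rw [integral_add (hφ.const_mul u) (hφ1.const_mul v), integral_const_mul, integral_const_mul]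
    have := setIntegral_mono_on ((hmax f hf hf1).add (hl g hg hg1))
      ((hmax g hg hg1).add (hl f hf hf1)) measurableSet_Ioi key
    simp only [Pi.add_apply] at this
    rw [integral_add (hmax f hf hf1) (hl g hg hg1), integral_add (hmax g hg hg1) (hl f hf hf1),
      hlv f hf hf1, hlv g hg hg1, h0, h1] at this
    linarith
  by_cases hc : c ∈ S
  · have hbdd : BddBelow S := ⟨0, fun t ht => ht.1.le⟩
    have hlow : ∀ t, t ∉ S → t ≤ c → t ≤ sInf S := fun t ht htc =>
      le_csInf ⟨c, hc⟩ fun s hs => by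
        by_contra! h
        exact ht (hS.out hs hc ⟨h.le, htc⟩)
    have hinf : ∀ t ∈ S, sInf S ≤ t := fun t ht => csInf_le hbdd ht
    generalize sInf S = α at hlow hinf
    have hαc := hinf c hc
    by_cases hab : BddAbove S
    · have hup : ∀ t, t ∉ S → c ≤ t → sSup S ≤ t := fun t ht htc =>
        csSup_le ⟨c, hc⟩ fun s hs => by
          by_contra! h
          exact ht (hS.out hc hs ⟨htc, h.le⟩)
      have hsup : ∀ t ∈ S, t ≤ sSup S := fun t ht => le_csSup hab ht
      generalize sSup S = β at hup hsup
      have hcβ := hsup c hc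
      -- Slope of the chord of `max c` from `(α, c)` to `(β, β)`.
      obtain ⟨v, hv0, hv1, hv⟩ : ∃ v : ℝ, 0 ≤ v ∧ v ≤ 1 ∧ v * (β - α) = β - c := by
        rcases (hαc.trans hcβ).eq_or_lt with h | h
        · exact ⟨0, le_rfl, zero_le_one, by linarith⟩
        · refine ⟨(β - c) / (β - α), div_nonneg (by linarith) (by linarith),
            (div_le_one (by linarith)).2 (by linarith), div_mul_cancel₀ _ (by linarith)⟩
      refine ⟨c - v * α, v, fun t ht => max_le ?_ ?_, fun t _ ht => ?_⟩
      · nlinarith [hinf t ht]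
      · nlinarith [hsup t ht]
      · rcases le_total t c with h | h
        · refine le_trans ?_ (le_max_left _ _)
          nlinarith [hlow t ht h]
        · refine le_trans ?_ (le_max_right _ _)
          nlinarith [hup t ht h]
    -- As `β → ∞` the chord becomes the line of slope 1 through `(α, c)`.
    · refine ⟨c - α, 1, fun t ht => max_le ?_ ?_, fun t _ ht => ?_⟩
      · linarith [hinf t ht]
      · linarith
      · rcases le_total t c with h | h
        · exact le_trans (by linarith [hlow t ht h]) (le_max_left _ _)
        · exfalso
          refine hab ⟨t, fun s hs => ?_⟩
          by_contra! h'
          exact ht (hS.out hc hs ⟨h, h'.le⟩)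
  -- Now `S` lies on one side of `c`, where `max c` is itself affine.
  · by_cases hlt : ∃ t ∈ S, t < c
    · obtain ⟨s, hs, hsc⟩ := hlt
      refine ⟨c, 0, fun t ht => ?_, fun t _ _ => by simp⟩
      have : t ≤ c := by
        by_contra! h
        exact hc (hS.out hs ht ⟨hsc.le, h.le⟩)
      simp [this]
    · push Not at hlt
      exact ⟨0, 1, fun t ht => by simp [hlt t ht], fun t _ _ => by simp⟩

end Crossing

/-! ### The density of `T_p` and its crossings. -/

section Density

open Real

/-- The density of `exp (-|x| ^ p)`, normalised to a probability density. -/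
def expWeight (p x : ℝ) : ℝ := exp (-|x| ^ p) / (2 * Gamma (1 / p + 1))

/-- The density of `Γ(1/p) * u ^ (p - 1)`, where `u > 0` has density `2 * expWeight p u`. -/
def powDensity (p t : ℝ) : ℝ :=
  (p - 1)⁻¹ * (Gamma (1 / p))⁻¹ * (t / Gamma (1 / p)) ^ ((p - 1)⁻¹ - 1) *
    (exp (-(t / Gamma (1 / p)) ^ ((p - 1)⁻¹ * p)) / Gamma (1 / p + 1))

variable {p q : ℝ}

/-- Change of variables `t = Γ(1/p) x^(p-1)`, injective only because `p > 1`. -/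
theorem setIntegral_mul_expWeight (hp : 1 < p) (φ : ℝ → ℝ) :
    ∫ x in Ioi (0 : ℝ), φ (Gamma (1 / p) * x ^ (p - 1)) * (2 * expWeight p x) =
      ∫ t in Ioi (0 : ℝ), φ t * powDensity p t := by
  have hk : 0 < Gamma (1 / p) := Gamma_pos_of_pos (by positivity)
  have hα : 0 < (p - 1)⁻¹ := inv_pos.2 (by linarith)
  rw [← integral_comp_rpow_Ioi_of_pos hα]
  have h2 := integral_comp_mul_left_Ioi (fun t => φ t * powDensity p t) 0 hk
  rw [mul_zero] at h2
  rw [← mul_right_inj' (inv_ne_zero hk.ne'), ← smul_eq_mul, ← smul_eq_mul, ← h2, ← integral_smul]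
  refine setIntegral_congr_fun measurableSet_Ioi fun y (hy : 0 < y) => ?_
  have e1 : (y ^ (p - 1)⁻¹) ^ (p - 1) = y := by
    rw [← rpow_mul hy.le, inv_mul_cancel₀ (by linarith), rpow_one]
  have e2 : |y ^ (p - 1)⁻¹| ^ p = y ^ ((p - 1)⁻¹ * p) := by
    rw [abs_of_nonneg (rpow_nonneg hy.le _), ← rpow_mul hy.le]
  have e3 : Gamma (1 / p) * y / Gamma (1 / p) = y := mul_div_cancel_left₀ _ hk.ne'
  simp only [smul_eq_mul, expWeight, powDensity, e1, e2, e3]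
  have hΓ : Gamma (1 / p + 1) ≠ 0 := (Gamma_pos_of_pos (by positivity)).ne'
  field_simp

theorem setIntegral_expWeight (hp : 1 ≤ p) : ∫ x in Ioi (0 : ℝ), 2 * expWeight p x = 1 := by
  have hΓ : Gamma (1 / p + 1) ≠ 0 := (Gamma_pos_of_pos (by positivity)).ne'
  have h : ∀ x ∈ Ioi (0 : ℝ), 2 * expWeight p x = exp (-x ^ p) * (Gamma (1 / p + 1))⁻¹ := by
    intro x hx
    rw [expWeight, abs_of_pos hx]; field_simp
  rw [setIntegral_congr_fun measurableSet_Ioi h, integral_mul_const,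
    integral_exp_neg_rpow (by linarith), mul_inv_cancel₀ hΓ]

/-- The factor `Γ(1/p)` is chosen for this: the mean of `T_p` does not depend on `p`. -/
theorem setIntegral_rpow_mul_expWeight (hp : 1 ≤ p) :
    ∫ x in Ioi (0 : ℝ), (Gamma (1 / p) * x ^ (p - 1)) * (2 * expWeight p x) = 1 := by
  have hp0 : 0 < p := by linarith
  have hk : 0 < Gamma (1 / p) := Gamma_pos_of_pos (by positivity)
  have h : ∀ x ∈ Ioi (0 : ℝ), (Gamma (1 / p) * x ^ (p - 1)) * (2 * expWeight p x) =
      (x ^ (p - 1) * exp (-x ^ p)) * p := by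
    intro x hx
    rw [expWeight, abs_of_pos hx, Gamma_add_one (by positivity)]; field_simp
  rw [setIntegral_congr_fun measurableSet_Ioi h, integral_mul_const,
    integral_rpow_mul_exp_neg_rpow hp0 (by linarith), sub_add_cancel, div_self hp0.ne',
    Gamma_one, mul_one, one_div_mul_cancel hp0.ne']

theorem setIntegral_powDensity (hp : 1 < p) : ∫ t in Ioi (0 : ℝ), powDensity p t = 1 := by
  have := setIntegral_mul_expWeight hp fun _ => 1
  simp only [one_mul] at this
  rw [← this]
  exact setIntegral_expWeight hp.le

theorem setIntegral_mul_powDensity (hp : 1 < p) :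
    ∫ t in Ioi (0 : ℝ), t * powDensity p t = 1 := by
  rw [← setIntegral_mul_expWeight hp fun t => t]
  exact setIntegral_rpow_mul_expWeight hp.le

theorem powDensity_eq_exp (hp : 1 < p) : ∃ C β : ℝ, 0 < β ∧ ∀ t, 0 < t →
    powDensity p t = exp (C + (p / (p - 1) - 2) * log t - β * t ^ (p / (p - 1))) := by
  have hk : 0 < Gamma (1 / p) := Gamma_pos_of_pos (by positivity)
  have hΓ : 0 < Gamma (1 / p + 1) := Gamma_pos_of_pos (by positivity)
  have hp1 : 0 < p - 1 := by linarith
  refine ⟨log ((p - 1)⁻¹ * (Gamma (1 / p))⁻¹ / Gamma (1 / p + 1)) -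
    (p / (p - 1) - 2) * log (Gamma (1 / p)), (Gamma (1 / p) ^ (p / (p - 1)))⁻¹, by positivity,
    fun t ht => ?_⟩
  have e1 : (p - 1)⁻¹ - 1 = p / (p - 1) - 2 := by field_simp; ring
  have e2 : (p - 1)⁻¹ * p = p / (p - 1) := by field_simp
  have e3 : log ((p - 1)⁻¹ * (Gamma (1 / p))⁻¹ / Gamma (1 / p + 1)) -
    (p / (p - 1) - 2) * log (Gamma (1 / p)) + (p / (p - 1) - 2) * log t -
    (Gamma (1 / p) ^ (p / (p - 1)))⁻¹ * t ^ (p / (p - 1)) =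
    log ((p - 1)⁻¹ * (Gamma (1 / p))⁻¹ / Gamma (1 / p + 1)) +
    log (t / Gamma (1 / p)) * (p / (p - 1) - 2) + -(t / Gamma (1 / p)) ^ (p / (p - 1)) := by
    rw [div_rpow ht.le hk.le, log_div ht.ne' hk.ne']; ring
  rw [e3, exp_add, exp_add, exp_log (by positivity), ← rpow_def_of_pos (by positivity), powDensity,
    e1, e2]
  ring

/-- With conjugate exponents `r > r'`, the log-ratio of the densities is a constant plus `(r - r')
log t - β t^r + β' t^r'`. In the variable `x = t^r'` it is concave, so it is positive on an
interval. -/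
theorem ordConnected_powDensity_lt (hp : 1 < p) (hpq : p < q) :
    OrdConnected {t : ℝ | 0 < t ∧ powDensity q t < powDensity p t} := by
  have hq : 1 < q := hp.trans hpq
  obtain ⟨C, β, hβ, hC⟩ := powDensity_eq_exp hp
  obtain ⟨C', β', hβ', hC'⟩ := powDensity_eq_exp hq
  set r := p / (p - 1) with hr
  set r' := q / (q - 1) with hr'
  have hr'0 : 0 < r' := div_pos (by linarith) (by linarith)
  have hrr : r' < r := by
    rw [hr, hr', div_lt_div_iff₀ (by linarith) (by linarith)]; nlinarith
  have hconc : ConcaveOn ℝ (Ioi 0) fun x : ℝ =>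
      ((r - r') / r') * log x + β * -x ^ (r / r') + β' * x + (C - C') := by
    have h1 : ConcaveOn ℝ (Ioi 0) log := strictConcaveOn_log_Ioi.concaveOn
    have h2 : ConcaveOn ℝ (Ioi 0) fun x : ℝ => -x ^ (r / r') :=
      ((convexOn_rpow (by rw [le_div_iff₀ hr'0]; linarith)).subset Ioi_subset_Ici_self
        (convex_Ioi 0)).neg
    have h3 : ConcaveOn ℝ (Ioi 0) fun x : ℝ => x := concaveOn_id (convex_Ioi 0)
    have := (((h1.smul (c := (r - r') / r') (div_nonneg (by linarith) hr'0.le)).add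
      (h2.smul hβ.le)).add (h3.smul hβ'.le)).add_const (C - C')
    convert! this using 2 with x
  have hconv := (hconc.convex_gt 0).ordConnected
  have hiff : ∀ t : ℝ, 0 < t → (powDensity q t < powDensity p t ↔
      t ^ r' ∈ {x : ℝ | x ∈ Ioi (0 : ℝ) ∧
        0 < ((r - r') / r') * log x + β * -x ^ (r / r') + β' * x + (C - C')}) := by
    intro t ht
    have e1 : (t ^ r') ^ (r / r') = t ^ r := by
      rw [← rpow_mul ht.le, mul_div_cancel₀ _ hr'0.ne']
    have e2 : (r - r') / r' * log (t ^ r') = (r - r') * log t := by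
      rw [log_rpow ht]; field_simp
    have e3 : 0 < t ^ r' := rpow_pos_of_pos ht _
    rw [hC t ht, hC' t ht, exp_lt_exp]
    simp only [mem_ofPred_eq, mem_Ioi, e1, e2, e3, true_and]
    constructor <;> intro h <;> linarith
  constructor
  rintro x ⟨hx, hx'⟩ y ⟨hy, hy'⟩ z ⟨hxz, hzy⟩
  have hz : 0 < z := hx.trans_le hxz
  exact ⟨hz, (hiff z hz).2 (hconv.out ((hiff x hx).1 hx') ((hiff y hy).1 hy')
    ⟨rpow_le_rpow hx.le hxz hr'0.le, rpow_le_rpow hz.le hzy hr'0.le⟩)⟩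

end Density

/-! ### Monotonicity in `p` for one variable. -/

section Monotone

open Real

variable {p q : ℝ}

theorem integrableOn_expWeight (hp : 1 ≤ p) : IntegrableOn (fun x => 2 * expWeight p x) (Ioi 0) :=
  Integrable.of_integral_ne_zero (by rw [setIntegral_expWeight hp]; exact one_ne_zero)

theorem integrableOn_rpow_mul_expWeight (hp : 1 ≤ p) :
    IntegrableOn (fun x => (Gamma (1 / p) * x ^ (p - 1)) * (2 * expWeight p x)) (Ioi 0) :=
  Integrable.of_integral_ne_zero (by rw [setIntegral_rpow_mul_expWeight hp]; exact one_ne_zero)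

theorem integrableOn_max_mul_expWeight (hp : 1 ≤ p) (c : ℝ) :
    IntegrableOn (fun x => max c (Gamma (1 / p) * x ^ (p - 1)) * (2 * expWeight p x)) (Ioi 0) :=
  integrable_max_mul (by fun_prop) (integrableOn_expWeight hp)
    (integrableOn_rpow_mul_expWeight hp) c

theorem expWeight_nonneg (hp : 1 ≤ p) (x : ℝ) : 0 ≤ expWeight p x :=
  div_nonneg (exp_pos _).le (mul_pos two_pos (Gamma_pos_of_pos (by positivity))).le

theorem expWeight_neg (x : ℝ) : expWeight p (-x) = expWeight p x := by
  simp [expWeight]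

theorem measurable_expWeight : Measurable (expWeight p) := by
  unfold expWeight
  fun_prop

theorem le_setIntegral_max_mul_expWeight (hp : 1 ≤ p) (c : ℝ) :
    max c 1 ≤ ∫ x in Ioi (0 : ℝ), max c (Gamma (1 / p) * x ^ (p - 1)) * (2 * expWeight p x) := by
  have hw : ∀ x, 0 ≤ 2 * expWeight p x := fun x => mul_nonneg two_pos.le (expWeight_nonneg hp x)
  refine max_le ?_ ?_
  · have := setIntegral_mono_on ((integrableOn_expWeight hp).const_mul c)
      (integrableOn_max_mul_expWeight hp c) measurableSet_Ioi
      fun x _ => mul_le_mul_of_nonneg_right (le_max_left _ _) (hw x)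
    rwa [integral_const_mul, setIntegral_expWeight hp, mul_one] at this
  · have := setIntegral_mono_on (integrableOn_rpow_mul_expWeight hp)
      (integrableOn_max_mul_expWeight hp c) measurableSet_Ioi
      fun x _ => mul_le_mul_of_nonneg_right (le_max_right _ _) (hw x)
    rwa [setIntegral_rpow_mul_expWeight hp] at this

theorem setIntegral_max_mul_expWeight_mono (hp : 1 ≤ p) (hpq : p ≤ q) (c : ℝ) :
    ∫ x in Ioi (0 : ℝ), max c (Gamma (1 / p) * x ^ (p - 1)) * (2 * expWeight p x) ≤
      ∫ x in Ioi (0 : ℝ), max c (Gamma (1 / q) * x ^ (q - 1)) * (2 * expWeight q x) := by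
  rcases hpq.eq_or_lt with rfl | hpq
  · rfl
  -- `T_1` is the constant 1 and has no density; here the claim is Jensen's inequality for `max c`.
  rcases hp.eq_or_lt with rfl | hp
  · convert! le_setIntegral_max_mul_expWeight hpq.le c using 1
    simp only [div_one, Gamma_one, sub_self, rpow_zero, mul_one]
    rw [integral_const_mul, setIntegral_expWeight le_rfl, mul_one]
  · have hint : ∀ {r : ℝ}, 1 < r → IntegrableOn (powDensity r) (Ioi 0) := fun hr =>
      Integrable.of_integral_ne_zero (by rw [setIntegral_powDensity hr]; exact one_ne_zero)
    have hint1 : ∀ {r : ℝ}, 1 < r → IntegrableOn (fun t => t * powDensity r t) (Ioi 0) :=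
      fun hr => Integrable.of_integral_ne_zero
        (by rw [setIntegral_mul_powDensity hr]; exact one_ne_zero)
    have hq := hp.trans hpq
    rw [setIntegral_mul_expWeight hp fun t => max c t, setIntegral_mul_expWeight hq fun t => max c t]
    exact setIntegral_max_mul_le_of_ordConnected (hint hp) (hint hq) (hint1 hp) (hint1 hq)
      ((setIntegral_powDensity hp).trans (setIntegral_powDensity hq).symm)
      ((setIntegral_mul_powDensity hp).trans (setIntegral_mul_powDensity hq).symm)
      (ordConnected_powDensity_lt hp hpq) c

theorem lintegral_eq_setLIntegral_Ioi_add_neg {F : ℝ → ENNReal} (hF : Measurable F) :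
    ∫⁻ x, F x = ∫⁻ x in Ioi (0 : ℝ), (F x + F (-x)) := by
  have h := (Measure.measurePreserving_neg (volume : Measure ℝ)).setLIntegral_comp_preimage_emb
    (MeasurableEquiv.neg ℝ).measurableEmbedding F (Iio 0)
  have h' : Neg.neg ⁻¹' Iio (0 : ℝ) = Ioi 0 := by ext; simp
  rw [h'] at h
  rw [lintegral_add_left hF, h, ← lintegral_add_compl _ (measurableSet_Ioi (a := (0 : ℝ))),
    compl_Ioi, setLIntegral_congr Iio_ae_eq_Iic.symm]

theorem abs_add_add_abs_sub_eq (s u : ℝ) : |s + u| + |s - u| = 2 * max |s| |u| := by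
  rcases abs_cases (s + u) with h | h <;> rcases abs_cases (s - u) with h' | h' <;>
  rcases abs_cases s with h1 | h1 <;> rcases abs_cases u with h2 | h2 <;>
  rcases max_cases |s| |u| with h3 | h3 <;> linarith

theorem measurable_const_mul_signedPow (hp : 1 ≤ p) (k : ℝ) :
    Measurable fun x => k * signedPow (p - 1) x :=
  (measurable_signedPow (by linarith)).const_mul k

/-- Pairing `x` with `-x` and using `|s + u| + |s - u| = 2 max(|s|, |u|)` removes the sign. -/
theorem lintegral_enorm_add_mul_signedPow (hp : 1 ≤ p) (s a : ℝ) :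
    ∫⁻ x, ‖s + a * (Gamma (1 / p) * signedPow (p - 1) x)‖ₑ * ENNReal.ofReal (expWeight p x) =
      ∫⁻ x in Ioi (0 : ℝ), ENNReal.ofReal
        (max |s| (|a| * (Gamma (1 / p) * x ^ (p - 1))) * (2 * expWeight p x)) := by
  have hk : 0 < Gamma (1 / p) := Gamma_pos_of_pos (by positivity)
  rw [lintegral_eq_setLIntegral_Ioi_add_neg]
  · refine setLIntegral_congr_fun measurableSet_Ioi fun x (hx : 0 < x) => ?_
    have hw := expWeight_nonneg hp x
    have hu : |a * (Gamma (1 / p) * x ^ (p - 1))| = |a| * (Gamma (1 / p) * x ^ (p - 1)) := by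
      rw [abs_mul, abs_of_nonneg (mul_nonneg hk.le (rpow_nonneg hx.le _))]
    simp only [signedPow_neg, expWeight_neg, signedPow_of_pos hx]
    rw [← add_mul, mul_neg, mul_neg, ← sub_eq_add_neg, Real.enorm_eq_ofReal_abs,
      Real.enorm_eq_ofReal_abs, ← ENNReal.ofReal_add (abs_nonneg _) (abs_nonneg _),
      ← ENNReal.ofReal_mul (by positivity), abs_add_add_abs_sub_eq, hu]
    congr 1; ring
  · exact (((measurable_const_mul_signedPow hp _).const_mul a).const_add s).enorm.mul
      measurable_expWeight.ennreal_ofReal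

theorem lintegral_enorm_add_mul_signedPow_mono (hp : 1 ≤ p) (hpq : p ≤ q) (s a : ℝ) :
    ∫⁻ x, ‖s + a * (Gamma (1 / p) * signedPow (p - 1) x)‖ₑ * ENNReal.ofReal (expWeight p x) ≤
      ∫⁻ x, ‖s + a * (Gamma (1 / q) * signedPow (q - 1) x)‖ₑ *
        ENNReal.ofReal (expWeight q x) := by
  have key : ∀ {r : ℝ}, 1 ≤ r → ∫⁻ x, ‖s + a * (Gamma (1 / r) * signedPow (r - 1) x)‖ₑ *
      ENNReal.ofReal (expWeight r x) = ENNReal.ofReal (if a = 0 then |s| else |a| *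
        ∫ x in Ioi (0 : ℝ), max (|s| / |a|) (Gamma (1 / r) * x ^ (r - 1)) *
          (2 * expWeight r x)) := by
    intro r hr
    have hw : ∀ x, 0 ≤ 2 * expWeight r x := fun x => mul_nonneg two_pos.le (expWeight_nonneg hr x)
    rw [lintegral_enorm_add_mul_signedPow hr]
    split_ifs with ha
    · simp only [ha, abs_zero, zero_mul, max_eq_left (abs_nonneg s)]
      rw [← ofReal_integral_eq_lintegral_ofReal ((integrableOn_expWeight hr).const_mul _)
        (ae_of_all _ fun x => mul_nonneg (abs_nonneg _) (hw x)), integral_const_mul,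
        setIntegral_expWeight hr, mul_one]
    · have ha' : 0 < |a| := abs_pos.2 ha
      rw [← integral_const_mul, ofReal_integral_eq_lintegral_ofReal
        ((integrableOn_max_mul_expWeight hr _).const_mul _)
        (ae_of_all _ fun x => mul_nonneg ha'.le
          (mul_nonneg (le_max_of_le_left (by positivity)) (hw x)))]
      refine lintegral_congr fun x => ?_
      rw [← mul_assoc |a| (max _ _), mul_max_of_nonneg _ _ ha'.le, mul_div_cancel₀ _ ha'.ne']
  rw [key hp, key (hp.trans hpq)]
  refine ENNReal.ofReal_le_ofReal ?_
  split_ifs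
  · rfl
  · exact mul_le_mul_of_nonneg_left (setIntegral_max_mul_expWeight_mono hp hpq _) (abs_nonneg _)

end Monotone

/-! ### From one variable to the sum, and the conclusion. -/

/-- Comparison of first absolute moments passes from one variable to sums of independent
variables. -/
theorem lintegral_enorm_add_sum_mono {ψ₁ ψ₂ : ℝ → ℝ} {w₁ w₂ : ℝ → ENNReal}
    (hψ₁ : Measurable ψ₁) (hψ₂ : Measurable ψ₂) (hw₁ : Measurable w₁) (hw₂ : Measurable w₂)
    (h : ∀ s a : ℝ, ∫⁻ x, ‖s + a * ψ₁ x‖ₑ * w₁ x ≤ ∫⁻ x, ‖s + a * ψ₂ x‖ₑ * w₂ x)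
    (n : ℕ) (s : ℝ) (a : Fin n → ℝ) :
    ∫⁻ x : Fin n → ℝ, ‖s + ∑ j, a j * ψ₁ (x j)‖ₑ * ∏ j, w₁ (x j) ≤
      ∫⁻ x : Fin n → ℝ, ‖s + ∑ j, a j * ψ₂ (x j)‖ₑ * ∏ j, w₂ (x j) := by
  -- The shift must vary: it absorbs the first variable when the induction hypothesis is used, and
  -- the remaining sum when `h` is.
  induction n generalizing s with
  | zero => simp
  | succ n ih =>
    have split : ∀ {ψ : ℝ → ℝ} {w : ℝ → ENNReal}, Measurable ψ → Measurable w →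
        ∫⁻ x : Fin (n + 1) → ℝ, ‖s + ∑ j, a j * ψ (x j)‖ₑ * ∏ j, w (x j) =
        ∫⁻ z : ℝ × (Fin n → ℝ), ‖(s + a 0 * ψ z.1) + ∑ j : Fin n, a j.succ * ψ (z.2 j)‖ₑ *
          (∏ j, w (z.2 j)) * w z.1 := by
      intro ψ w hψ hw
      rw [← (volume_preserving_piFinSuccAbove (fun _ : Fin (n + 1) => ℝ) 0).symm.lintegral_comp
        (by fun_prop)]
      refine lintegral_congr fun z => ?_
      simp [MeasurableEquiv.piFinSuccAbove_symm_apply, Fin.sum_univ_succ, Fin.prod_univ_succ,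
        add_assoc, mul_assoc, mul_comm]
    rw [split hψ₁ hw₁, split hψ₂ hw₂, Measure.volume_eq_prod]
    calc _ = ∫⁻ x, ∫⁻ y : Fin n → ℝ, ‖(s + a 0 * ψ₁ x) + ∑ j : Fin n, a j.succ * ψ₁ (y j)‖ₑ *
          (∏ j, w₁ (y j)) * w₁ x := lintegral_prod _ (by fun_prop)
      _ ≤ ∫⁻ x, ∫⁻ y : Fin n → ℝ, ‖(s + a 0 * ψ₁ x) + ∑ j : Fin n, a j.succ * ψ₂ (y j)‖ₑ *
          (∏ j, w₂ (y j)) * w₁ x := by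
        refine lintegral_mono fun x => ?_
        rw [lintegral_mul_const _ (by fun_prop), lintegral_mul_const _ (by fun_prop)]
        exact mul_le_mul_left (ih _ _) _
      _ = ∫⁻ y : Fin n → ℝ, ∫⁻ x, ‖(s + a 0 * ψ₁ x) + ∑ j : Fin n, a j.succ * ψ₂ (y j)‖ₑ *
          (∏ j, w₂ (y j)) * w₁ x := lintegral_lintegral_swap (by fun_prop)
      _ ≤ ∫⁻ y : Fin n → ℝ, ∫⁻ x, ‖(s + a 0 * ψ₂ x) + ∑ j : Fin n, a j.succ * ψ₂ (y j)‖ₑ *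
          (∏ j, w₂ (y j)) * w₂ x := by
        refine lintegral_mono fun y => ?_
        simp only [mul_right_comm _ (∏ j, w₂ (y j))]
        rw [lintegral_mul_const _ (by fun_prop), lintegral_mul_const _ (by fun_prop)]
        refine mul_le_mul_left ?_ _
        simpa only [add_right_comm] using h (s + ∑ j : Fin n, a j.succ * ψ₂ (y j)) (a 0)
      _ = _ := by
        rw [lintegral_prod_symm' _ (by fun_prop)]

theorem volume_projPerp_div_volume_lpBall {n : ℕ} {a : EuclideanSpace ℝ (Fin n)} {p : ℝ}
    (ha : ‖a‖ = 1) (hp : 1 ≤ p) :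
    volume (projPerp a (lpBall n p)) / volume (lpBall (n - 1) p) =
      ∫⁻ x : Fin n → ℝ, ‖0 + ∑ j, a j * (Real.Gamma (1 / p) * signedPow (p - 1) (x j))‖ₑ *
        ∏ j, ENNReal.ofReal (expWeight p (x j)) := by
  have hp0 : 0 < p := by linarith
  have hn : 0 < n := by
    rcases Nat.eq_zero_or_pos n with rfl | h
    · simp [Subsingleton.elim a 0] at ha
    · exact h
  have hΓ : 0 < Real.Gamma ((n - 1 : ℕ) / p + 1) := Real.Gamma_pos_of_pos (by positivity)
  have hk : 0 < Real.Gamma (1 / p) := Real.Gamma_pos_of_pos (by positivity)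
  have hΓ1 : 0 < Real.Gamma (1 / p + 1) := Real.Gamma_pos_of_pos (by positivity)
  have h := volume_projPerp_lpBall hp ha
  rw [← (PiLp.volume_preserving_toLp (Fin n)).lintegral_comp
    (measurable_sum_signedPow hp a)] at h
  set K := 2 * Real.Gamma (1 / p + 1) with hK
  have hKpos : 0 < K := by positivity
  have hint : ∀ x : Fin n → ℝ,
      ‖0 + ∑ j, a j * (Real.Gamma (1 / p) * signedPow (p - 1) (x j))‖ₑ *
        ∏ j, ENNReal.ofReal (expWeight p (x j)) =
      ENNReal.ofReal (Real.Gamma (1 / p) / (p * K ^ n)) *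
        ENNReal.ofReal (|∑ j, a j * (p * signedPow (p - 1) (x j))| *
          Real.exp (-∑ j, |x j| ^ p)) := by
    intro x
    have e1 : ∏ j, expWeight p (x j) = Real.exp (-∑ j, |x j| ^ p) / K ^ n := by
      simp [expWeight, Finset.prod_div_distrib, ← Real.exp_sum, hK]
    have e2 : ∀ c : ℝ, 0 < c → |∑ j, a j * (c * signedPow (p - 1) (x j))| =
        c * |∑ j, a j * signedPow (p - 1) (x j)| := by
      intro c hc
      rw [← abs_of_pos hc, ← abs_mul, abs_of_pos hc, Finset.mul_sum]
      congr 2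
      ext j; ring
    rw [zero_add, Real.enorm_eq_ofReal_abs, ← ENNReal.ofReal_prod_of_nonneg
      fun j _ => expWeight_nonneg hp _, ← ENNReal.ofReal_mul (abs_nonneg _),
      ← ENNReal.ofReal_mul (by positivity), e1, e2 _ hk, e2 _ hp0]
    congr 1
    field_simp
  rw [lintegral_congr hint, lintegral_const_mul' _ _ ENNReal.ofReal_ne_top]
  change _ = _ * ∫⁻ x : Fin n → ℝ, _
  rw [← h, volume_lpBall _ hp, ← mul_assoc, ENNReal.div_eq_inv_mul]
  congr 1
  rw [← ENNReal.ofReal_inv_of_pos (by positivity), ← ENNReal.ofReal_ofNat 2,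
    ← ENNReal.ofReal_mul (by positivity), ← ENNReal.ofReal_mul (by positivity)]
  congr 1
  -- Since `K = 2 Γ(1/p) / p`, the prefactor `2 Γ(1/p) / (p K^n)` is `1 / K^(n-1)`, the power in the
  -- volume of the lower-dimensional ball.
  obtain ⟨m, rfl⟩ : ∃ m, n = m + 1 := ⟨n - 1, by omega⟩
  rw [Nat.add_sub_cancel, pow_succ, hK, Real.Gamma_add_one (by positivity : 1 / p ≠ 0)]
  field_simp

end

theorem theorem3p7 (n : ℕ) (a : EuclideanSpace ℝ (Fin n)) (ha : ‖a‖ = 1) :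
    MonotoneOn
      (fun p : ℝ => volume (projPerp a (lpBall n p)) / volume (lpBall (n - 1) p))
      (Set.Ici 1) := by
  intro p (hp : 1 ≤ p) q (hq : 1 ≤ q) hpq
  simp only [volume_projPerp_div_volume_lpBall ha hp, volume_projPerp_div_volume_lpBall ha hq]
  exact lintegral_enorm_add_sum_mono (measurable_const_mul_signedPow hp _)
    (measurable_const_mul_signedPow hq _) measurable_expWeight.ennreal_ofReal
    measurable_expWeight.ennreal_ofReal (lintegral_enorm_add_mul_signedPow_mono hp hpq) n 0 a
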